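/- Conventions. Links are unoriented and considered up to isotopy. For integers $l_1,\dots,l_k$ let $D(l_1,\dots,l_k)$ be the trigonal diagram in Conway's open form: a diagram of a long link, drawn from left to right with at most three points on every vertical line, consisting of a left vertical tangent joining the two lower of three strands, then $|l_1|$ half twists of the two upper strands, $|l_2|$ half twists of the two lower strands, $|l_3|$ half twists of the two upper strands, and so on, and finally a right vertical tangent joining the middle strand with the (upper or lower) strand that is not used by the last twists. For odd $i$ the twists are right-handed if $l_i>0$ and left-handed if $l_i<0$; for even $i$ it is the other way round. It is a diagram of the link obtained by joining its two ends. If all $l_i>0$, this link is said to have Conway normal form $C(l_1,\dots,l_k)$. A trigonal diagram is a long link diagram with at most three points on every vertical line. A slide isotopy is an isotopy (a sequence of planar isotopies and Reidemeister moves) all of whose intermediate diagrams are trigonal and during which the number of crossings never increases. The complexity of $D(l_1,\dots,l_k)$ is $k+\sum_i|l_i|$. The diagram $D(l_1,\dots,l_k)$ is simple if no slide isotopy transforms it into a diagram $D(l'_1,\dots,l'_{k'})$, or into the image of such a diagram under the half turn around the horizontal axis (which has the same Conway notation), of lower complexity. It is awkward if it is simple and not alternating. Proposition. Let $k\ge 3$,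 let $m_1,\dots,m_k$ be positive integers with $m_1\ge 2$ and $m_k\ge 2$, and let $K$ be a two-bridge link of Conway normal form $C(m_1,\dots,m_k)$. Then $K$ possesses an awkward trigonal diagram. Explicitly, write $(m_{k-2},m_{k-1},m_k)=(m,a,n)$. If $a>1$, then $$D(m_1,\dots,m_{k-3},\,m+1,\,-1,\,1-a,\,-n)$$ is an awkward diagram of $K$; if $a=1$, then $$D(m_1,\dots,m_{k-3},\,m+1,\,-n-1)$$ is an awkward diagram of $K$. -/

import Mathlib

namespace TwoBridge

/-! ### Sliced link diagrams

A plane diagram (of a link, or of a long link running from left to right) in general position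
with respect to the projection to the horizontal axis is cut by vertical lines into elementary
pieces.  It is recorded by the list of these pieces, read from left to right.  On each vertical
line the strands are numbered `0, 1, 2, …` from top to bottom. -/

/-- Elementary pieces.  `cup i` is a left vertical tangent: it creates the strands `i, i + 1`.
`cap i` is a right vertical tangent: it joins and ends the strands `i, i + 1`.
`cross i s` is a crossing of the strands `i, i + 1`; for `s = true` the strand descending from
place `i` to place `i + 1` (from left to right) is the upper one, which is a right-handed half
twist; for `s = false` the ascending strand is the upper one (left-handed half twist). -/
inductive Piece where
  | cup (i : ℕ)
  | cap (i : ℕ)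
  | cross (i : ℕ) (s : Bool)

open Piece

/-- The topmost place where the piece acts. -/
def Piece.pos : Piece → ℕ
  | cup i => i
  | cap i => i
  | cross i _ => i

/-- The number of strands entering the piece from the left. -/
def Piece.ins : Piece → ℕ
  | cup _ => 0
  | cap _ => 2
  | cross _ _ => 2

/-- The number of strands leaving the piece on the right. -/
def Piece.outs : Piece → ℕ
  | cup _ => 2
  | cap _ => 0
  | cross _ _ => 2

/-- The same piece, acting at place `j`. -/
def Piece.moveTo : Piece → ℕ → Piece
  | cup _, j => cup j
  | cap _, j => cap j
  | cross _ s, j => cross j s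

/-- `IsTangle n w m`: the list `w` is a diagram with `n` ends on the left and `m` ends on the
right.  Links are the case `n = m = 0`, long links the case `n = m = 1`. -/
def IsTangle : ℕ → List Piece → ℕ → Prop
  | n, [], m => n = m
  | n, p :: w, m => p.pos + p.ins ≤ n ∧ IsTangle (n - p.ins + p.outs) w m

/-- Started with `n` strands, the diagram `w` never has more than `b` strands above a point of
the horizontal axis. -/
def WidthLE (b : ℕ) : ℕ → List Piece → Prop
  | n, [] => n ≤ b
  | n, p :: w => n ≤ b ∧ WidthLE b (n - p.ins + p.outs) w

/-- The number of crossings of a diagram. -/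
def crossings : List Piece → ℕ
  | [] => 0
  | cross _ _ :: w => crossings w + 1
  | _ :: w => crossings w

/-- The elementary moves of sliced diagrams: planar isotopies (`zigzag`, `exchange`), the passage
of a vertical tangent point over or under a strand (`slide`), and the three Reidemeister moves. -/
inductive LocalMove : List Piece → List Piece → Prop
  | zigzag_down (i : ℕ) : LocalMove [cup i, cap (i + 1)] []
  | zigzag_up (i : ℕ) : LocalMove [cup (i + 1), cap i] []
  | exchange (p q : Piece) (h : p.pos + p.outs ≤ q.pos) :
      LocalMove [p, q] [q.moveTo (q.pos - p.outs + p.ins), p]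
  | slide_cap (i : ℕ) (s : Bool) :
      LocalMove [cross i s, cap (i + 1)] [cross (i + 1) (!s), cap i]
  | slide_cup (i : ℕ) (s : Bool) :
      LocalMove [cup (i + 1), cross i s] [cup i, cross (i + 1) (!s)]
  | reidemeister_one_cap (i : ℕ) (s : Bool) : LocalMove [cross i s, cap i] [cap i]
  | reidemeister_one_cup (i : ℕ) (s : Bool) : LocalMove [cup i, cross i s] [cup i]
  | reidemeister_two (i : ℕ) (s : Bool) : LocalMove [cross i s, cross i (!s)] []
  | reidemeister_three (i : ℕ) (a b c : Bool) (h : a = b ∨ b = c) :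
      LocalMove [cross i a, cross (i + 1) b, cross i c]
        [cross (i + 1) c, cross i b, cross (i + 1) a]

/-- Two diagrams with `n` left and `m` right ends differ by one elementary move, performed
anywhere in the diagram and in either direction. -/
def Step (n m : ℕ) (w w' : List Piece) : Prop :=
  IsTangle n w m ∧ IsTangle n w' m ∧
    ∃ u v a b, w = u ++ a ++ v ∧ w' = u ++ b ++ v ∧ (LocalMove a b ∨ LocalMove b a)

/-! ### Links -/

/-- Diagrams of (closed, unoriented) links. -/
def LinkDiagram : Type := {w : List Piece // IsTangle 0 w 0}

/-- Isotopy of links: the equivalence relation generated by the elementary moves. -/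
instance isotopySetoid : Setoid LinkDiagram :=
  Relation.EqvGen.setoid fun d e => Step 0 0 d.1 e.1

/-- Isotopy classes of links in space. -/
def Link : Type := Quotient isotopySetoid

/-- The closure of a long link diagram: its two ends are joined by an arc above the diagram. -/
def closure (w : List Piece) : List Piece :=
  cup 0 :: (w.map (fun p => p.moveTo (p.pos + 1)) ++ [cap 0])

/-! ### Trigonal diagrams -/

/-- A trigonal diagram: a long link diagram with at most three points on every vertical line. -/
def IsTrigonal (w : List Piece) : Prop := IsTangle 1 w 1 ∧ WidthLE 3 1 w

/-- `|m|` half twists of the strands `i, i + 1`, right-handed for `m > 0`, left-handed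
for `m < 0`. -/
def twist (i : ℕ) (m : ℤ) : List Piece :=
  List.replicate m.natAbs (cross i (decide (0 < m)))

/-- The twists of a Conway diagram with consecutive numbers `m₁, m₂, …`.  They take place
alternately on the two upper and on the two lower strands, beginning with the strands
`i, i + 1`, where `i` is `0` or `1`; right twists count as positive for odd indices and as
negative for even indices (this is the role of `e = ±1`). -/
def twists : ℕ → ℤ → List ℤ → List Piece
  | _, _, [] => []
  | i, e, m :: l => twist i (e * m) ++ twists (1 - i) (-e) l

/-- For `i = 0`, the trigonal diagram `D(m₁, …, m_k)` in Conway's open form: the first twists are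
those of the two upper strands.  For `i = 1`, its image under the half turn around the horizontal
axis, which has the same Conway notation.  In both cases the strand not used by the first
(last) twists and the middle one are joined at the left (right). -/
def conwayDiagram (i : ℕ) (l : List ℤ) : List Piece :=
  cup (1 - i) :: (twists i 1 l ++ [cap (if Even l.length then i else 1 - i)])

/-- The trigonal diagram `D(m₁, …, m_k)`. -/
abbrev D (l : List ℤ) : List Piece := conwayDiagram 0 l

theorem isTangle_append {u v : List Piece} {n k m : ℕ} (hu : IsTangle n u k)
    (hv : IsTangle k v m) : IsTangle n (u ++ v) m := by
  induction u generalizing n with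
  | nil => simp only [IsTangle] at hu; subst hu; simpa using hv
  | cons p u ih => exact ⟨hu.1, ih hu.2⟩

theorem widthLE_append {u v : List Piece} {b n k : ℕ} (hu : IsTangle n u k)
    (hub : WidthLE b n u) (hv : WidthLE b k v) : WidthLE b n (u ++ v) := by
  induction u generalizing n with
  | nil => simp only [IsTangle] at hu; subst hu; simpa using hv
  | cons p u ih => exact ⟨hub.1, ih hu.2 hub.2⟩

theorem isTangle_crossings {u : List Piece} {n : ℕ}
    (h : ∀ p ∈ u, ∃ i s, p = cross i s ∧ i + 2 ≤ n) : IsTangle n u n := by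
  induction u with
  | nil => rfl
  | cons p u ih =>
    obtain ⟨i, s, rfl, hi⟩ := h p (by simp)
    have e : n - 2 + 2 = n := by omega
    refine ⟨hi, ?_⟩
    simp only [Piece.ins, Piece.outs, e]
    exact ih fun q hq => h q (by simp [hq])

theorem widthLE_crossings {u : List Piece} {n : ℕ}
    (h : ∀ p ∈ u, ∃ i s, p = cross i s ∧ i + 2 ≤ n) : WidthLE n n u := by
  induction u with
  | nil => exact le_refl n
  | cons p u ih =>
    obtain ⟨i, s, rfl, hi⟩ := h p (by simp)
    have e : n - 2 + 2 = n := by omega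
    refine ⟨le_refl n, ?_⟩
    simp only [Piece.ins, Piece.outs, e]
    exact ih fun q hq => h q (by simp [hq])

theorem mem_twists {l : List ℤ} {i : ℕ} {e : ℤ} (hi : i ≤ 1) {p : Piece}
    (hp : p ∈ twists i e l) : ∃ j s, p = cross j s ∧ j + 2 ≤ 3 := by
  induction l generalizing i e with
  | nil => simp [twists] at hp
  | cons m l ih =>
    simp only [twists, List.mem_append] at hp
    rcases hp with hp | hp
    · exact ⟨i, _, List.eq_of_mem_replicate hp, by omega⟩
    · exact ih (by omega) hp

theorem isTrigonal_conwayDiagram {i : ℕ} (hi : i ≤ 1) (l : List ℤ) :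
    IsTrigonal (conwayDiagram i l) := by
  have ht : ∀ p ∈ twists i 1 l, ∃ j s, p = cross j s ∧ j + 2 ≤ 3 := fun _ hp => mem_twists hi hp
  have hc : (if Even l.length then i else 1 - i) ≤ 1 := by split_ifs <;> omega
  refine ⟨⟨?_, isTangle_append (isTangle_crossings ht) ⟨?_, rfl⟩⟩,
    ⟨by omega, widthLE_append (isTangle_crossings ht) (widthLE_crossings ht) ⟨?_, ?_⟩⟩⟩
  all_goals simp only [Piece.pos, Piece.ins, Piece.outs, WidthLE]; omega

theorem isTangle_shift {u : List Piece} {n m : ℕ} (h : IsTangle n u m) :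
    IsTangle (n + 1) (u.map fun p => p.moveTo (p.pos + 1)) (m + 1) := by
  induction u generalizing n with
  | nil => simp only [IsTangle] at h; subst h; rfl
  | cons p u ih =>
    obtain ⟨h1, h2⟩ := h
    have h3 := ih h2
    cases p with
    | cup i => exact ⟨by simp only [Piece.moveTo, Piece.pos, Piece.ins] at *; omega, h3⟩
    | cap i =>
      simp only [Piece.moveTo, Piece.pos, Piece.ins, Piece.outs] at *
      refine ⟨by simp only [Piece.pos, Piece.ins]; omega, ?_⟩
      have e : n + 1 - 2 + 0 = n - 2 + 0 + 1 := by omega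
      simp only [Piece.ins, Piece.outs, e]
      exact h3
    | cross i s =>
      simp only [Piece.moveTo, Piece.pos, Piece.ins, Piece.outs] at *
      refine ⟨by simp only [Piece.pos, Piece.ins]; omega, ?_⟩
      have e : n + 1 - 2 + 2 = n - 2 + 2 + 1 := by omega
      simp only [Piece.ins, Piece.outs, e]
      exact h3

theorem isTangle_closure {w : List Piece} (h : IsTangle 1 w 1) : IsTangle 0 (closure w) 0 :=
  ⟨le_refl 0, isTangle_append (isTangle_shift h) ⟨le_refl 2, rfl⟩⟩

/-- The two-bridge link with diagram `D(m₁, …, m_k)`.  If all `mᵢ` have the same sign, this is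
the link of Conway normal form `C(m₁, …, m_k)`. -/
def conwayLink (l : List ℤ) : Link :=
  Quotient.mk isotopySetoid
    ⟨closure (D l), isTangle_closure (isTrigonal_conwayDiagram (Nat.zero_le 1) l).1⟩

/-! ### Slide isotopies, simple and awkward diagrams -/

/-- One elementary move between trigonal diagrams that does not increase the number of
crossings. -/
def SlideStep (w w' : List Piece) : Prop :=
  Step 1 1 w w' ∧ IsTrigonal w ∧ IsTrigonal w' ∧ crossings w' ≤ crossings w

/-- Slide isotopies: all the intermediate diagrams are trigonal, and the number of crossings
never increases. -/
def SlideIsotopic : List Piece → List Piece → Prop := Relation.ReflTransGen SlideStep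

/-- The complexity `k + ∑ |mᵢ|` of `D(m₁, …, m_k)`. -/
def complexity (l : List ℤ) : ℕ := l.length + (l.map Int.natAbs).sum

/-- `D(l)` is simple: slide isotopies lead from it to no Conway diagram of lower complexity
(in either of the two positions of that diagram). -/
def IsSimple (l : List ℤ) : Prop :=
  ∀ (i : ℕ) (l' : List ℤ), i ≤ 1 → SlideIsotopic (D l) (conwayDiagram i l') →
    complexity l ≤ complexity l'

/-- Auxiliary recursion for `IsAlternating`; the list of Booleans gives directions to the strands
on the vertical line at the left of the diagram (`true` is from left to right). -/
def AltFrom : List Piece → List Bool → Prop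
  | [], _ => True
  | cup i :: w, d => ∃ x y b, x.length = i ∧ d = x ++ y ∧ AltFrom w (x ++ b :: (!b) :: y)
  | cap i :: w, d => ∃ x y b, x.length = i ∧ d = x ++ b :: (!b) :: y ∧ AltFrom w (x ++ y)
  | cross i s :: w, d => ∃ x y, x.length = i ∧ d = x ++ (!s) :: s :: y ∧ AltFrom w d

/-- A long link diagram is alternating if over- and undercrossings alternate along each
component, that is, if no arc between two consecutive crossing points is over at both ends or
under at both ends.  Equivalently one can direct the arcs so that at every crossing both arcs of
the upper strand leave the crossing point and both arcs of the lower strand arrive there. -/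
def IsAlternating (w : List Piece) : Prop := ∃ b : Bool, AltFrom w [b]

/-- `D(l)` is awkward: simple and not alternating. -/
def IsAwkward (l : List ℤ) : Prop := IsSimple l ∧ ¬ IsAlternating (D l)

end TwoBridge

/-!
Write `a, b` for the right-handed half twists of the two upper and of the two lower strands and
`A, B` for the left-handed ones.  An alternating Conway diagram with positive entries is a word in
the letters `a` and `B`.  Let `α` be the letter of `a, B` that makes up the twists counted by
`mₖ₋₂`, let `β` be the letter of `A, b` on the other pair of strands, and let `ᾱ`, `β̄` be their inverses.
Put `p = mₖ₋₁ - 1`, `m = mₖ₋₂` and `n = mₖ`, and let `i` be the place of `α`.  In both cases the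
diagram that is claimed to be awkward is

  `cup 1, y, α, β, ᾱ ^ p, β ^ n, cap i`,

where `y` is an alternating word ending with `α ^ m`, and the given diagram of the link is
`cup 1, y, β̄ ^ (p + 1), α ^ n, cap (1 - i)`.

*Isotopy.*  Reidemeister moves of type three give `β̄ ^ p α β = α β ᾱ ^ p` and
`α ^ n β α = β α β ^ n`; the latter, together with a slide of the right tangent and one move of type
one, turns `β̄ α ^ n cap (1 - i)` into `α β ^ (n + 1) cap i` (`replaceable_fold`).

*Simplicity.*  A trigonal diagram is a sequence of blocks consisting of a left tangent, a three
strand braid word and a right tangent.  Since the number of crossings may not increase and there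
is no room for a fourth strand, a slide isotopy changes a block only by moves of type three, by
slides of its two tangents and by moves of type one and two that delete crossings; besides, blocks
without crossings that represent a zigzag may come and go.  Starting with the diagram above, the
block with crossings runs through the finitely many words
`y, β̄ ^ j, α, β, ᾱ ^ (p - j), β ^ n` and their images under the slides of the two tangents; in
none of them can a crossing be deleted, because `m₁ ≥ 2` and `n ≥ 2`.  To check
this without decomposing lists, the set of all these diagrams is described by a deterministic
automaton (`next`), and for each move one verifies that both sides have the same effect on
each state, or that the side with more crossings is rejected (`run_localMove`).  Hence acceptance
is invariant under slide isotopies (`run_of_slideIsotopic`).  Finally a potential on the states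
bounds the complexity of an accepted Conway diagram from below (`complexity_of_run`), and the
diagram above attains this bound.

*Not alternating.*  The middle strand at the crossings `α, β`, which follow each other and have
the same handedness, would need both directions (`not_isAlternating`).
-/

namespace TwoBridge

open Piece

/-! ### An automaton for the slide isotopy class -/

/-- The states of the automaton that recognizes the diagrams met on the way.  The width of a state
is the number of strands on the current vertical line.

* `start`: nothing but zigzags has been read;
* `left c`: the last piece read is `cup c`;
* `pre t`: of the alternating word `y` there remain the letters at the places `t` and a last `α`;
* `mid k`: `y` has been read, and `k` letters `β̄` or `ᾱ` are still to come;
* `turn k`: the same, but `α` has been read in addition;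
* `back k`: the same, but `α β` has been read in addition;
* `tail k`: there remain `k + 1` crossings, all of them `β`, except that the last one may
  be `ᾱ` in place of `β`;
* `last c`: there remains `cap c`;
* `done`: the block has been read, and nothing but zigzags has followed;
* `zig c`: after the block, a zigzag beginning with `cup c` is being read. -/
inductive State where
  | start
  | left (c : ℕ)
  | pre (t : List ℕ)
  | mid (k : ℕ)
  | turn (k : ℕ)
  | back (k : ℕ)
  | tail (k : ℕ)
  | last (c : ℕ)
  | done
  | zig (c : ℕ)

open State

/-- The number of strands on the vertical line at which the automaton is in the given state. -/
def State.width : State → ℕ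
  | start => 1
  | done => 1
  | _ => 3

/-- The transitions of the automaton; `none` means rejection.  The parameters are the place `i` of
the letter `α`, the exponent `p`, the exponent `n = r + 2` and the list `y` of the places of the
alternating word without its first and its last letter.  The alternating letter at the place `d` is
`cross d (decide (d = 0))`, its inverse is `cross d (decide (d ≠ 0))`.  From `left c` the first
letter is read at the place `1 - c`, which takes account of the slide of the left tangent. -/
def next (i p r : ℕ) (y : List ℕ) : State → Piece → Option State
  | start, cup c => if c ≤ 1 then some (left c) else none
  | left c, cap d => if c + d = 1 then some start else none
  | left c, cross d s => if c + d = 1 ∧ s = decide (d = 0) then some (pre y) else none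
  | pre [], cross d s => if d = i ∧ s = decide (d = 0) then some (mid p) else none
  | pre (c :: t), cross d s => if d = c ∧ s = decide (d = 0) then some (pre t) else none
  | mid 0, cross d s => if d = i ∧ s = decide (d = 0) then some (turn 0) else none
  | mid (k + 1), cross d s =>
      if s = decide (d = 0) then
        if d = i then some (turn (k + 1)) else if d + i = 1 then some (mid k) else none
      else none
  | turn k, cross d s => if d + i = 1 ∧ s = decide (d ≠ 0) then some (back k) else none
  | back 0, cross d s => if d + i = 1 ∧ s = decide (d ≠ 0) then some (tail r) else none
  | back (k + 1), cross d s => if d = i ∧ s = decide (d ≠ 0) then some (back k) else none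
  | tail 0, cross d s =>
      if s = decide (d ≠ 0) then
        if d = i then some (last (1 - i)) else if d + i = 1 then some (last i) else none
      else none
  | tail (k + 1), cross d s => if d + i = 1 ∧ s = decide (d ≠ 0) then some (tail k) else none
  | last c, cap d => if d = c then some done else none
  | done, cup c => if c ≤ 1 then some (zig c) else none
  | zig c, cap d => if c + d = 1 then some done else none
  | _, _ => none

/-- The state reached from a given state by reading a diagram. -/
def run (i p r : ℕ) (y : List ℕ) : State → List Piece → Option State
  | q, [] => some q
  | q, x :: w => (next i p r y q x).bind fun q' => run i p r y q' w

variable {i p r : ℕ} {y : List ℕ}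

theorem run_append (q : State) (u v : List Piece) :
    run i p r y q (u ++ v) = (run i p r y q u).bind fun q' => run i p r y q' v := by
  induction u generalizing q with
  | nil => rfl
  | cons x u ih =>
    simp only [List.cons_append, run, Option.bind_assoc]
    congr 1
    funext q'
    exact ih q'

/-- Only the numbers of ends matter here: the places of the letters are not constrained by `next`.
-/
theorem width_next {q q' : State} {x : Piece} (h : next i p r y q x = some q') :
    q'.width = q.width - x.ins + x.outs := by
  unfold next at h
  split at h
  all_goals first
    | (simp at h; done)
    | (repeat' split at h) <;> simp at h <;> subst h <;> rfl

theorem width_run {q q' : State} {u : List Piece} {k : ℕ} (h : run i p r y q u = some q')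
    (hu : IsTangle q.width u k) : q'.width = k := by
  induction u generalizing q with
  | nil => simp only [run, Option.some.injEq] at h; subst h; exact hu
  | cons x u ih =>
    simp only [run, Option.bind_eq_some_iff] at h
    obtain ⟨q₁, h₁, h₂⟩ := h
    exact ih h₂ (width_next h₁ ▸ hu.2)

theorem isTangle_append_iff {u v : List Piece} {n m : ℕ} :
    IsTangle n (u ++ v) m ↔ ∃ k, IsTangle n u k ∧ IsTangle k v m := by
  refine ⟨fun h => ?_, fun ⟨k, hu, hv⟩ => isTangle_append hu hv⟩
  induction u generalizing n with
  | nil => exact ⟨n, rfl, h⟩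
  | cons x u ih =>
    obtain ⟨k, hk, hv⟩ := ih h.2
    exact ⟨k, ⟨h.1, hk⟩, hv⟩

theorem WidthLE.left {b n : ℕ} {u v : List Piece} (h : WidthLE b n (u ++ v)) : WidthLE b n u := by
  induction u generalizing n with
  | nil => cases v with
    | nil => exact h
    | cons x v => exact h.1
  | cons x u ih => exact ⟨h.1, ih h.2⟩

theorem WidthLE.right {b n k : ℕ} {u v : List Piece} (hu : IsTangle n u k)
    (h : WidthLE b n (u ++ v)) : WidthLE b k v := by
  induction u generalizing n with
  | nil => simp only [IsTangle] at hu; subst hu; exact h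
  | cons x u ih => exact ih hu.2 h.2

theorem crossings_append (u v : List Piece) : crossings (u ++ v) = crossings u + crossings v := by
  induction u with
  | nil => simp [crossings]
  | cons x u ih => cases x <;> simp only [List.cons_append, crossings, ih]; omega

theorem State.width_eq (q : State) : q.width = 1 ∨ q.width = 3 := by
  cases q <;> simp [State.width]

/-- An exchange of two distant pieces needs more than three strands. -/
theorem exchange_width {x z : Piece} {n k : ℕ}
    (h : x.pos + x.outs ≤ z.pos) (ha : IsTangle n [x, z] k) (wa : WidthLE 3 n [x, z])
    (wb : WidthLE 3 n [z.moveTo (z.pos - x.outs + x.ins), x]) : False := by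
  cases x <;> cases z <;>
    simp only [IsTangle, WidthLE, Piece.pos, Piece.ins, Piece.outs, Piece.moveTo] at * <;> omega

/-! ### Invariance under slide steps -/

/-- The hypothesis `hy` says that the second crossing is at the place `0`, that is `m₁ ≥ 2`. After
`cup 0` the word begins with `B a`, and no third letter completes this to a side of a
Reidemeister move of type three that is accepted. -/
theorem run_reidemeister_three_left (hy : ∃ t, y ++ [i] = 0 :: t) (c : ℕ) (hi : i = 0 ∨ i = 1)
    {s₁ s₂ s₃ : Bool} (h : s₁ = s₂ ∨ s₂ = s₃) :
    run i p r y (left c) [cross 0 s₁, cross 1 s₂, cross 0 s₃] =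
      run i p r y (left c) [cross 1 s₃, cross 0 s₂, cross 1 s₁] := by
  obtain ⟨t, ht⟩ := hy
  rcases y with _ | ⟨c₁, _ | ⟨_ | _ | c₂, y⟩⟩ <;>
    simp only [List.nil_append, List.cons_append, List.cons.injEq] at ht <;>
    obtain rfl := ht.1 <;>
    rcases hi with hi | hi <;> (try cases hi) <;> rcases c with _ | _ | c <;>
    rcases p with _ | p <;>
    cases s₁ <;> cases s₂ <;> cases s₃ <;> first | rfl | exact absurd h (by decide)

theorem run_reidemeister_three_pre (t : List ℕ) (hi : i = 0 ∨ i = 1) {s₁ s₂ s₃ : Bool}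
    (h : s₁ = s₂ ∨ s₂ = s₃) :
    run i p r y (pre t) [cross 0 s₁, cross 1 s₂, cross 0 s₃] =
      run i p r y (pre t) [cross 1 s₃, cross 0 s₂, cross 1 s₁] := by
  rcases t with _ | ⟨_ | _ | c₁, _ | ⟨_ | _ | c₂, _ | ⟨_ | _ | c₃, t⟩⟩⟩ <;>
    rcases hi with rfl | rfl <;> rcases p with _ | _ | p <;>
    cases s₁ <;> cases s₂ <;> cases s₃ <;> first | rfl | exact absurd h (by decide)

theorem run_reidemeister_three_mid (k : ℕ) (hi : i = 0 ∨ i = 1) (s₁ s₂ s₃ : Bool) :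
    run i p r y (mid k) [cross 0 s₁, cross 1 s₂, cross 0 s₃] =
      run i p r y (mid k) [cross 1 s₃, cross 0 s₂, cross 1 s₁] := by
  rcases k with _ | _ | _ | k <;> rcases hi with rfl | rfl <;>
    cases s₁ <;> cases s₂ <;> cases s₃ <;> rfl

theorem run_reidemeister_three_turn (k : ℕ) (hi : i = 0 ∨ i = 1) {s₁ s₂ s₃ : Bool}
    (h : s₁ = s₂ ∨ s₂ = s₃) :
    run i p r y (turn k) [cross 0 s₁, cross 1 s₂, cross 0 s₃] =
      run i p r y (turn k) [cross 1 s₃, cross 0 s₂, cross 1 s₁] := by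
  rcases k with _ | _ | _ | k <;> rcases r with _ | r <;> rcases hi with rfl | rfl <;>
    cases s₁ <;> cases s₂ <;> cases s₃ <;> first | rfl | exact absurd h (by decide)

theorem run_reidemeister_three_back (k : ℕ) (hi : i = 0 ∨ i = 1) {s₁ s₂ s₃ : Bool}
    (h : s₁ = s₂ ∨ s₂ = s₃) :
    run i p r y (back k) [cross 0 s₁, cross 1 s₂, cross 0 s₃] =
      run i p r y (back k) [cross 1 s₃, cross 0 s₂, cross 1 s₁] := by
  rcases k with _ | _ | _ | k <;> rcases r with _ | r <;> rcases hi with rfl | rfl <;>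
    cases s₁ <;> cases s₂ <;> cases s₃ <;> first | rfl | exact absurd h (by decide)

theorem run_reidemeister_three_tail (k : ℕ) (hi : i = 0 ∨ i = 1) (s₁ s₂ s₃ : Bool) :
    run i p r y (tail k) [cross 0 s₁, cross 1 s₂, cross 0 s₃] =
      run i p r y (tail k) [cross 1 s₃, cross 0 s₂, cross 1 s₁] := by
  rcases k with _ | _ | _ | k <;> rcases hi with rfl | rfl <;>
    cases s₁ <;> cases s₂ <;> cases s₃ <;> rfl

/-- A Reidemeister move of type three does not change the effect of a diagram on any state.  The two
sides are accepted only when they are `β̄ α β` and `α β ᾱ`. -/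
theorem run_reidemeister_three (hi : i = 0 ∨ i = 1) (hy : ∃ t, y ++ [i] = 0 :: t) (q : State)
    {s₁ s₂ s₃ : Bool} (h : s₁ = s₂ ∨ s₂ = s₃) :
    run i p r y q [cross 0 s₁, cross 1 s₂, cross 0 s₃] =
      run i p r y q [cross 1 s₃, cross 0 s₂, cross 1 s₁] := by
  cases q with
  | start => rfl
  | done => rfl
  | zig c => rfl
  | last c => rfl
  | left c => exact run_reidemeister_three_left hy c hi h
  | pre t => exact run_reidemeister_three_pre t hi h
  | mid k => exact run_reidemeister_three_mid k hi _ _ _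
  | turn k => exact run_reidemeister_three_turn k hi h
  | back k => exact run_reidemeister_three_back k hi h
  | tail k => exact run_reidemeister_three_tail k hi _ _ _

/-- No diagram that is accepted has two consecutive crossings which cancel. -/
theorem run_reidemeister_two (hi : i = 0 ∨ i = 1) (hy : ∃ t, y ++ [i] = 0 :: t) (q : State)
    {c : ℕ} (hc : c = 0 ∨ c = 1) (s : Bool) :
    run i p r y q [cross c s, cross c (!s)] = none := by
  cases q with
  | start => rfl
  | done => rfl
  | zig d => rfl
  | last d => rfl
  | left d =>
    obtain ⟨t, ht⟩ := hy
    rcases y with _ | ⟨c₁, y⟩ <;>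
      simp only [List.nil_append, List.cons_append, List.cons.injEq] at ht <;>
      obtain rfl := ht.1 <;> rcases d with _ | _ | d <;> rcases hc with rfl | rfl <;>
      cases s <;> rfl
  | pre t =>
    rcases t with _ | ⟨_ | _ | c₁, _ | ⟨_ | _ | c₂, t⟩⟩ <;> rcases p with _ | p <;>
      rcases hi with rfl | rfl <;> rcases hc with rfl | rfl <;> cases s <;> rfl
  | mid k =>
    rcases k with _ | _ | k <;>
      rcases hi with rfl | rfl <;> rcases hc with rfl | rfl <;> cases s <;> rfl
  | turn k =>
    rcases k with _ | k <;>
      rcases hi with rfl | rfl <;> rcases hc with rfl | rfl <;> cases s <;> rfl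
  | back k =>
    rcases k with _ | _ | k <;> rcases r with _ | r <;>
      rcases hi with rfl | rfl <;> rcases hc with rfl | rfl <;> cases s <;> rfl
  | tail k =>
    rcases k with _ | _ | k <;>
      rcases hi with rfl | rfl <;> rcases hc with rfl | rfl <;> cases s <;> rfl

theorem run_slide_cap (hi : i = 0 ∨ i = 1) (q : State) (s : Bool) :
    run i p r y q [cross 0 s, cap 1] = run i p r y q [cross 1 (!s), cap 0] := by
  cases q with
  | start => rfl
  | done => rfl
  | zig d => rfl
  | last d => rfl
  | left e =>
    rcases e with _ | _ | e <;> rcases y with _ | ⟨c₁, y⟩ <;> cases s <;> rfl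
  | pre t =>
    rcases t with _ | ⟨_ | _ | c₁, _ | ⟨c₂, t⟩⟩ <;> rcases p with _ | p <;>
      rcases hi with rfl | rfl <;> cases s <;> rfl
  | mid k =>
    rcases k with _ | _ | k <;>
      rcases hi with rfl | rfl <;> cases s <;> rfl
  | turn k =>
    rcases k with _ | k <;> rcases hi with rfl | rfl <;> cases s <;> rfl
  | back k =>
    rcases k with _ | _ | k <;> rcases r with _ | r <;>
      rcases hi with rfl | rfl <;> cases s <;> rfl
  | tail k =>
    rcases k with _ | _ | k <;>
      rcases hi with rfl | rfl <;> cases s <;> rfl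

/-- No diagram that is accepted has a crossing which can be removed at a right tangent. -/
theorem run_reidemeister_one_cap (hi : i = 0 ∨ i = 1) (q : State) {c : ℕ} (hc : c = 0 ∨ c = 1)
    (s : Bool) : run i p r y q [cross c s, cap c] = none := by
  cases q with
  | start => rfl
  | done => rfl
  | zig d => rfl
  | last d => rfl
  | left e =>
    rcases e with _ | _ | e <;> rcases y with _ | ⟨c₁, y⟩ <;>
      rcases hc with rfl | rfl <;> cases s <;> rfl
  | pre t =>
    rcases t with _ | ⟨_ | _ | c₁, _ | ⟨c₂, t⟩⟩ <;> rcases p with _ | p <;>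
      rcases hi with rfl | rfl <;> rcases hc with rfl | rfl <;> cases s <;> rfl
  | mid k =>
    rcases k with _ | _ | k <;>
      rcases hi with rfl | rfl <;> rcases hc with rfl | rfl <;> cases s <;> rfl
  | turn k =>
    rcases k with _ | k <;> rcases hi with rfl | rfl <;> rcases hc with rfl | rfl <;>
      cases s <;> rfl
  | back k =>
    rcases k with _ | _ | k <;> rcases r with _ | r <;>
      rcases hi with rfl | rfl <;> rcases hc with rfl | rfl <;> cases s <;> rfl
  | tail k =>
    rcases k with _ | _ | k <;>
      rcases hi with rfl | rfl <;> rcases hc with rfl | rfl <;> cases s <;> rfl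

/-- An elementary move within width three either does not change the effect of a diagram on the
state `q`, or it removes crossings and its left side is rejected. -/
theorem run_localMove (hi : i = 0 ∨ i = 1) (hy : ∃ t, y ++ [i] = 0 :: t) (q : State)
    {u v : List Piece} (h : LocalMove u v) {k l : ℕ}
    (hu : IsTangle q.width u k) (wu : WidthLE 3 q.width u)
    (hv : IsTangle q.width v l) (wv : WidthLE 3 q.width v) :
    run i p r y q u = run i p r y q v ∨ crossings v < crossings u ∧ run i p r y q u = none := by
  have hq := q.width_eq
  cases h with
  | exchange x z h => exact (exchange_width h hu wu wv).elim
  | zigzag_down c =>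
    left
    simp only [IsTangle, WidthLE, Piece.pos, Piece.ins, Piece.outs] at hu wu
    cases q <;> simp only [State.width] at hu wu <;> try omega
    all_goals
      obtain rfl : c = 0 := by omega
      rfl
  | zigzag_up c =>
    left
    simp only [IsTangle, WidthLE, Piece.pos, Piece.ins, Piece.outs] at hu wu
    cases q <;> simp only [State.width] at hu wu <;> try omega
    all_goals
      obtain rfl : c = 0 := by omega
      rfl
  | reidemeister_three c s₁ s₂ s₃ h =>
    left
    simp only [IsTangle, WidthLE, Piece.pos, Piece.ins, Piece.outs] at hu wu
    obtain rfl : c = 0 := by omega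
    exact run_reidemeister_three hi hy q h
  | slide_cap c s =>
    left
    simp only [IsTangle, WidthLE, Piece.pos, Piece.ins, Piece.outs] at hu wu
    obtain rfl : c = 0 := by omega
    exact run_slide_cap hi q s
  | slide_cup c s =>
    left
    simp only [IsTangle, WidthLE, Piece.pos, Piece.ins, Piece.outs] at hu wu
    cases q <;> simp only [State.width] at hu wu <;>
      first | omega | (obtain rfl : c = 0 := (by omega); cases s <;> rfl)
  | reidemeister_one_cap c s =>
    right
    simp only [IsTangle, WidthLE, Piece.pos, Piece.ins, Piece.outs] at hu wu
    have hc : c = 0 ∨ c = 1 := by omega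
    exact ⟨by simp [crossings], run_reidemeister_one_cap hi q hc s⟩
  | reidemeister_one_cup c s =>
    right
    simp only [IsTangle, WidthLE, Piece.pos, Piece.ins, Piece.outs] at hu wu
    refine ⟨by simp [crossings], ?_⟩
    cases q <;> simp only [State.width] at hu wu <;> try omega
    all_goals
      have hc : c = 0 ∨ c = 1 := by omega
      rcases hc with rfl | rfl <;> rfl
  | reidemeister_two c s =>
    right
    simp only [IsTangle, WidthLE, Piece.pos, Piece.ins, Piece.outs] at hu wu
    have hc : c = 0 ∨ c = 1 := by omega
    exact ⟨by simp [crossings], run_reidemeister_two hi hy q hc s⟩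

/-- Acceptance by the automaton is invariant under slide steps. -/
theorem SlideStep.run_eq_done (hi : i = 0 ∨ i = 1) (hy : ∃ t, y ++ [i] = 0 :: t)
    {w w' : List Piece} (h : SlideStep w w') (hw : run i p r y start w = some done) :
    run i p r y start w' = some done := by
  obtain ⟨⟨-, -, u, v, a, b, rfl, rfl, hab⟩, ⟨ht, hwd⟩, ⟨ht', hwd'⟩, hc⟩ := h
  simp only [List.append_assoc] at ht hwd ht' hwd' hw ⊢
  rw [run_append, Option.bind_eq_some_iff] at hw
  obtain ⟨q, hq, hw⟩ := hw
  rw [run_append, hq, Option.bind_some]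
  obtain ⟨k, hk, ht⟩ := isTangle_append_iff.1 ht
  obtain ⟨k', hk', ht'⟩ := isTangle_append_iff.1 ht'
  obtain rfl : q.width = k := width_run hq hk
  obtain rfl : q.width = k' := width_run hq hk'
  have wa := (WidthLE.right hk hwd).left
  have wb := (WidthLE.right hk hwd').left
  obtain ⟨l, ha, -⟩ := isTangle_append_iff.1 ht
  obtain ⟨l', hb, -⟩ := isTangle_append_iff.1 ht'
  rw [run_append] at hw ⊢
  simp only [crossings_append] at hc
  rcases hab with hab | hab
  · rcases run_localMove (p := p) (r := r) hi hy q hab ha wa hb wb with h | ⟨-, h⟩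
    · rwa [← h]
    · simp [h] at hw
  · rcases run_localMove (p := p) (r := r) hi hy q hab hb wb ha wa with h | ⟨h, -⟩
    · rwa [h]
    · omega

/-! ### A lower bound for the complexity -/

/-- The contribution to the complexity of a crossing at the place `d` if the previous one is at the
place `c`: it counts `1` as a crossing, and `1` more if it begins a new group of twists. -/
def cost (c d : ℕ) : ℕ := if d = c then 1 else 2

/-- The contribution to the complexity of crossings at the given places, the previous one being at
`c`. -/
def pathCost : ℕ → List ℕ → ℕ
  | _, [] => 0
  | c, d :: t => cost c d + pathCost d t

/-- A lower bound for the contribution to the complexity of all the crossings that can be read from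
the given state before `done`, the previous crossing being at the place `c`.  The summands that
depend on `p` are those of `mid p` at the place `i`: if `p = 0`, then `α β ^ (n + 1)` is
optimal with one change of place, otherwise there are at least three changes. -/
def potential (i p r : ℕ) (y : List ℕ) : State → ℕ → ℕ
  | left e, c => cost c (1 - e) + (pathCost (1 - e) (y ++ [i]) + if p = 0 then r + 5 else p + r + 7)
  | pre t, c => pathCost c (t ++ [i]) + if p = 0 then r + 5 else p + r + 7
  | mid 0, c => if c = i then r + 5 else r + 6
  | mid (k + 1), c => if c = i then k + r + 8 else k + r + 7
  | turn 0, c => if c = i then r + 4 else r + 3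
  | turn (k + 1), c => if c = i then k + r + 7 else k + r + 6
  | back 0, c => if c = i then r + 3 else r + 2
  | back (k + 1), c => if c = i then k + r + 4 else k + r + 5
  | tail k, _ => k + 1
  | _, _ => 0

theorem cost_le (c c' d : ℕ) : cost c d ≤ cost c' d + 1 := by
  unfold cost; split_ifs <;> omega

theorem pathCost_le (c c' : ℕ) (t : List ℕ) : pathCost c t ≤ pathCost c' t + 1 := by
  cases t with
  | nil => simp [pathCost]
  | cons d t => have := cost_le c c' d; simp only [pathCost]; omega

theorem potential_le (q : State) (c c' : ℕ) :
    potential i p r y q c ≤ potential i p r y q c' + 1 := by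
  unfold potential
  split
  · have := cost_le c c' (1 - ‹ℕ›); omega
  · have := pathCost_le c c' (‹List ℕ› ++ [i]); omega
  all_goals first | omega | (split_ifs <;> omega)

theorem potential_next (hi : i = 0 ∨ i = 1) {q q' : State} {d : ℕ} {s : Bool}
    (h : next i p r y q (cross d s) = some q') :
    potential i p r y q d ≤ potential i p r y q' d + 1 := by
  rcases q with _ | e | (_ | ⟨e, t⟩) | (_ | k) | k | (_ | k) | (_ | k) | e | _ | e
  all_goals
    simp only [next, Option.ite_none_right_eq_some, Option.some.injEq, reduceCtorEq] at h
  case left =>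
    obtain ⟨⟨h, -⟩, rfl⟩ := h
    obtain rfl : d = 1 - e := by omega
    simp only [potential, cost, if_true]
    omega
  case pre.nil =>
    obtain ⟨⟨rfl, -⟩, rfl⟩ := h
    rcases p with _ | p <;>
      simp only [potential, pathCost, cost, List.nil_append, if_true, Nat.succ_ne_zero,
        if_false] <;>
      omega
  case pre.cons =>
    obtain ⟨⟨rfl, -⟩, rfl⟩ := h
    simp only [potential, pathCost, cost, List.cons_append, if_true]
    omega
  case mid.zero =>
    obtain ⟨⟨rfl, -⟩, rfl⟩ := h
    simp only [potential, if_true]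
    omega
  case mid.succ =>
    obtain ⟨-, h⟩ := h
    split at h
    · obtain rfl : _ = q' := by simpa using h
      simp_all only [potential, if_true]
      omega
    · obtain ⟨h', rfl⟩ : d + i = 1 ∧ mid k = q' := by simpa using h
      rcases k with _ | k <;> simp_all only [potential, if_false] <;> omega
  case turn =>
    obtain ⟨⟨h, -⟩, rfl⟩ := h
    have hd : d ≠ i := by omega
    rcases k with _ | k <;> simp only [potential, hd, if_false] <;> omega
  case back.zero =>
    obtain ⟨⟨h, -⟩, rfl⟩ := h
    have hd : d ≠ i := by omega
    simp only [potential, hd, if_false]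
    omega
  case back.succ =>
    obtain ⟨⟨rfl, -⟩, rfl⟩ := h
    rcases k with _ | k <;> simp only [potential, if_true] <;> omega
  case tail.zero =>
    simp only [potential]
    omega
  case tail.succ =>
    obtain ⟨-, rfl⟩ := h
    simp only [potential]
    omega

theorem potential_run_replicate (hi : i = 0 ∨ i = 1) {q q' : State} {d : ℕ} {s : Bool} {m : ℕ}
    (h : run i p r y q (List.replicate m (cross d s)) = some q') :
    potential i p r y q d ≤ potential i p r y q' d + m := by
  induction m generalizing q with
  | zero => simp only [List.replicate, run, Option.some.injEq] at h; subst h; omega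
  | succ m ih =>
    simp only [List.replicate, run, Option.bind_eq_some_iff] at h
    obtain ⟨q₁, h₁, h₂⟩ := h
    have := potential_next hi h₁
    have := ih h₂
    omega

theorem complexity_cons (m : ℤ) (l : List ℤ) :
    complexity (m :: l) = 1 + m.natAbs + complexity l := by
  simp only [complexity, List.length_cons, List.map_cons, List.sum_cons]
  omega

theorem complexity_append (x z : List ℤ) :
    complexity (x ++ z) = complexity x + complexity z := by
  simp only [complexity, List.length_append, List.map_append, List.sum_append]
  omega

/-- A group of twists at the place `c` adds its entry to the complexity, and the `1` that it adds
in any case, even if it is empty, pays for the change of place (`potential_le`). -/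
theorem potential_le_complexity (hi : i = 0 ∨ i = 1) {q : State} {c d : ℕ} (hc : c ≤ 1) {e : ℤ}
    (he : e.natAbs = 1) {l : List ℤ} (h : run i p r y q (twists c e l ++ [cap d]) = some done) :
    potential i p r y q (1 - c) ≤ complexity l := by
  induction l generalizing q c e with
  | nil =>
    simp only [twists, List.nil_append, run] at h
    rcases q with _ | e | (_ | ⟨e, t⟩) | (_ | k) | k | (_ | k) | (_ | k) | e | _ | e
    all_goals simp [next] at h
    all_goals simp [potential]
  | cons m l ih =>
    simp only [twists, List.append_assoc] at h
    rw [run_append, Option.bind_eq_some_iff] at h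
    obtain ⟨q', h₁, h₂⟩ := h
    have h₃ := ih (by omega : 1 - c ≤ 1) (by simpa using he : (-e).natAbs = 1) h₂
    rw [show 1 - (1 - c) = c by omega] at h₃
    have h₄ := potential_run_replicate hi h₁
    have h₅ := potential_le (i := i) (p := p) (r := r) (y := y) q (1 - c) c
    rw [Int.natAbs_mul, he, one_mul] at h₄
    rw [complexity_cons]
    omega

/-- A Conway diagram that is accepted, in either position, has at least the stated complexity. -/
theorem complexity_of_run (hi : i = 0 ∨ i = 1) (hy : ∃ t, y ++ [i] = 0 :: t) {c : ℕ} (hc : c ≤ 1)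
    {l : List ℤ} (h : run i p r y start (conwayDiagram c l) = some done) :
    (pathCost 0 (y ++ [i]) + if p = 0 then r + 7 else p + r + 9) ≤ complexity l := by
  have hc' : c = 0 ∨ c = 1 := by omega
  have h : run i p r y (left (1 - c))
      (twists c 1 l ++ [cap (if Even l.length then c else 1 - c)]) = some done := by
    rcases hc' with rfl | rfl <;> exact h
  have h₁ := potential_le_complexity hi hc rfl h
  obtain ⟨t, ht⟩ := hy
  rcases hc' with rfl | rfl <;> simp [potential, cost, ht, pathCost] at h₁ ⊢ <;>
    split_ifs at h₁ ⊢ <;> omega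

/-! ### Alternating words and awkward diagrams -/

/-- The alternating letters: `a` at the place `0` and `B` at the place `1`. -/
def alt (c : ℕ) : Piece := cross c (decide (c = 0))

/-- The inverses of the alternating letters: `A` at the place `0` and `b` at the place `1`. -/
def anti (c : ℕ) : Piece := cross c (decide (c ≠ 0))

theorem run_pre (t : List ℕ) (w : List Piece) :
    run i p r y (pre t) ((t ++ [i]).map alt ++ w) = run i p r y (mid p) w := by
  induction t with
  | nil => simp [run, next, alt]
  | cons c t ih => simpa [run, next, alt] using ih

theorem run_mid (hi : i = 0 ∨ i = 1) (k : ℕ) (w : List Piece) :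
    run i p r y (mid k) (alt i :: anti (1 - i) :: w) = run i p r y (back k) w := by
  rcases hi with rfl | rfl <;> cases k <;> rfl

theorem run_back (hi : i = 0 ∨ i = 1) (k : ℕ) (w : List Piece) :
    run i p r y (back k) (List.replicate k (anti i) ++ anti (1 - i) :: w) =
      run i p r y (tail r) w := by
  induction k with
  | zero => rcases hi with rfl | rfl <;> rfl
  | succ k ih => simpa [run, next, anti, List.replicate_succ] using ih

theorem run_tail (hi : i = 0 ∨ i = 1) (k : ℕ) :
    run i p r y (tail k) (List.replicate (k + 1) (anti (1 - i)) ++ [cap i]) = some done := by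
  induction k with
  | zero => rcases hi with rfl | rfl <;> rfl
  | succ k ih =>
    rcases hi with rfl | rfl <;> rw [List.replicate_succ] <;> exact ih

theorem run_start (hi : i = 0 ∨ i = 1) :
    run i p r y start (cup 1 :: ((0 :: (y ++ [i])).map alt ++ alt i :: anti (1 - i) ::
      (List.replicate p (anti i) ++ (List.replicate (r + 2) (anti (1 - i)) ++ [cap i])))) =
      some done := by
  change run i p r y (pre y) _ = _
  change run i p r y (pre y) ((y ++ [i]).map alt ++ _) = _
  rw [run_pre, run_mid hi, List.replicate_succ, List.cons_append, run_back hi, run_tail hi]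

/-- The places of the crossings of the twists `l`, the first ones being at the place `c`. -/
def positions : ℕ → List ℤ → List ℕ
  | _, [] => []
  | c, m :: l => List.replicate m.natAbs c ++ positions (1 - c) l

/-- The sign `e` for which `twists c e` turns positive entries into alternating letters. -/
def altSign (c : ℕ) : ℤ := if c = 0 then 1 else -1

theorem altSign_flip {c : ℕ} (hc : c ≤ 1) : altSign (1 - c) = -altSign c := by
  have : c = 0 ∨ c = 1 := by omega
  rcases this with rfl | rfl <;> rfl

theorem twist_of_pos {c : ℕ} {m : ℤ} (hm : 0 < m) :
    twist c (altSign c * m) = List.replicate m.natAbs (alt c) := by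
  unfold twist altSign alt
  split_ifs with h <;> simp [h] <;> omega

theorem twist_of_nonpos {c : ℕ} {m : ℤ} (hm : m ≤ 0) :
    twist c (altSign c * m) = List.replicate m.natAbs (anti c) := by
  unfold twist altSign anti
  rcases eq_or_lt_of_le hm with rfl | hm
  · simp
  · split_ifs with h <;> simp [h] <;> omega

theorem twists_append {c : ℕ} (hc : c ≤ 1) (x z : List ℤ) :
    twists c (altSign c) (x ++ z) = twists c (altSign c) x ++
      twists ((c + x.length) % 2) (altSign ((c + x.length) % 2)) z := by
  induction x generalizing c with
  | nil => simp [twists, Nat.mod_eq_of_lt (by omega : c < 2)]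
  | cons m x ih =>
    have h := ih (by omega : 1 - c ≤ 1)
    rw [show (1 - c + x.length) % 2 = (c + (m :: x).length) % 2 by
      simp only [List.length_cons]; omega, altSign_flip hc] at h
    simp only [List.cons_append, twists, h, List.append_assoc]

theorem twists_of_pos {c : ℕ} (hc : c ≤ 1) {x : List ℤ} (hx : ∀ t ∈ x, 0 < t) :
    twists c (altSign c) x = (positions c x).map alt := by
  induction x generalizing c with
  | nil => rfl
  | cons m x ih =>
    have h := ih (by omega : 1 - c ≤ 1) fun t ht => hx t (by simp [ht])
    rw [altSign_flip hc] at h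
    simp only [twists, positions, List.map_append, List.map_replicate, h,
      twist_of_pos (hx m (by simp))]

theorem conwayDiagram_append {x : List ℤ} (hx : ∀ t ∈ x, 0 < t) (z : List ℤ) :
    D (x ++ z) = cup 1 :: ((positions 0 x).map alt ++
      (twists (x.length % 2) (altSign (x.length % 2)) z ++
        [cap (if Even z.length then x.length % 2 else 1 - x.length % 2)])) := by
  have h := twists_append (Nat.zero_le 1) x z
  rw [twists_of_pos (Nat.zero_le 1) hx, Nat.zero_add] at h
  have hcap : (if Even (x ++ z).length then 0 else 1 - 0) =
      if Even z.length then x.length % 2 else 1 - x.length % 2 := by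
    simp only [List.length_append, Nat.even_iff]
    split_ifs <;> omega
  rw [D, conwayDiagram, hcap, show (1 : ℤ) = altSign 0 from rfl, h, List.append_assoc]

theorem pathCost_replicate (c m : ℕ) (t : List ℕ) :
    pathCost c (List.replicate m c ++ t) = m + pathCost c t := by
  induction m with
  | zero => simp
  | succ m ih =>
    simp only [List.replicate_succ, List.cons_append, pathCost, ih, cost, if_true]
    omega

/-- The alternating word with its `x.length + 1` groups changes its place `x.length` times. -/
theorem pathCost_positions {c e m : ℕ} (hc : c ≤ 1) (hm : 0 < m) {x : List ℤ}
    (hx : ∀ t ∈ x, 0 < t) (he : e = (c + x.length) % 2) :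
    pathCost c (positions c x ++ List.replicate m e) = complexity x + m := by
  induction x generalizing c with
  | nil =>
    obtain rfl : e = c := by simp only [List.length_nil] at he; omega
    simpa [positions, pathCost, complexity] using pathCost_replicate e m []
  | cons k x ih =>
    have h := ih (by omega : 1 - c ≤ 1) (fun t ht => hx t (by simp [ht]))
      (by simp only [List.length_cons] at he; omega)
    have hs : ∃ t, positions (1 - c) x ++ List.replicate m e = (1 - c) :: t := by
      rcases x with _ | ⟨k', x⟩
      · obtain rfl : e = 1 - c := by simp only [List.length_cons, List.length_nil] at he; omega
        obtain ⟨m, rfl⟩ := Nat.exists_eq_succ_of_ne_zero hm.ne'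
        exact ⟨_, rfl⟩
      · have hk := hx k' (by simp)
        obtain ⟨n, hn⟩ := Nat.exists_eq_succ_of_ne_zero (Int.natAbs_ne_zero.2 hk.ne')
        exact ⟨_, by rw [positions, hn, List.replicate_succ]; rfl⟩
    obtain ⟨t, ht⟩ := hs
    rw [positions, List.append_assoc, pathCost_replicate, complexity_cons]
    rw [ht] at h ⊢
    simp only [pathCost, cost, if_true] at h ⊢
    rw [if_neg (by omega)]
    omega

/-- If the first entry is at least `2`, the first two crossings of the alternating word are at the
place `0`, and its last crossing is not the first one. -/
theorem exists_positions_eq {x : List ℤ} (hx : ∀ t ∈ x, 0 < t) {m : ℕ} (hm : 0 < m)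
    (h2 : ∀ t ∈ (x ++ [(m : ℤ)]).head?, 2 ≤ t) :
    ∃ y, positions 0 x ++ List.replicate m (x.length % 2) = 0 :: (y ++ [x.length % 2]) ∧
      ∃ t, y ++ [x.length % 2] = 0 :: t := by
  obtain ⟨m, rfl⟩ := Nat.exists_eq_succ_of_ne_zero hm.ne'
  rcases x with _ | ⟨k, x⟩
  · have : 2 ≤ ((m + 1 : ℕ) : ℤ) := h2 _ (by simp)
    obtain ⟨m, rfl⟩ := Nat.exists_eq_succ_of_ne_zero (by omega : m ≠ 0)
    refine ⟨List.replicate m 0, ?_, List.replicate m 0, ?_⟩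
    · rw [List.replicate_succ, List.replicate_succ']; rfl
    · exact List.replicate_succ'.symm
  · have : 2 ≤ k := h2 _ (by simp)
    obtain ⟨k, rfl⟩ : ∃ k' : ℕ, k = k' + 2 := ⟨(k - 2).toNat, by omega⟩
    have hk : ((k : ℤ) + 2).natAbs = k + 2 := by omega
    refine ⟨0 :: (List.replicate k 0 ++ positions 1 x ++
      List.replicate m ((((k : ℤ) + 2) :: x).length % 2)), ?_, _, rfl⟩
    rw [positions, hk, List.replicate_succ, List.replicate_succ, List.replicate_succ']
    simp

/-- At `alt i` the directions of the strands `i, i + 1` are determined, and so are those of the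
strands `1 - i, 2 - i` at `anti (1 - i)`; these requirements disagree on the middle strand. -/
theorem not_isAlternating {i : ℕ} (hi : i = 0 ∨ i = 1) (u v : List Piece) :
    ¬ IsAlternating (u ++ alt i :: anti (1 - i) :: v) := by
  rintro ⟨b, h⟩
  generalize [b] = d at h
  induction u generalizing d with
  | nil =>
    obtain ⟨x₁, y₁, h₁, h₁', x₂, y₂, h₂, h₂', -⟩ := h
    rw [h₁'] at h₂'
    rcases hi with rfl | rfl
    · obtain rfl := List.length_eq_zero_iff.1 h₁
      obtain ⟨z, rfl⟩ := List.length_eq_one_iff.1 h₂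
      simp at h₂'
    · obtain rfl := List.length_eq_zero_iff.1 h₂
      obtain ⟨z, rfl⟩ := List.length_eq_one_iff.1 h₁
      simp at h₂'
  | cons q u ih =>
    cases q with
    | cup c => obtain ⟨_, _, _, _, _, h⟩ := h; exact ih _ h
    | cap c => obtain ⟨_, _, _, _, _, h⟩ := h; exact ih _ h
    | cross c s => obtain ⟨_, _, _, _, h⟩ := h; exact ih _ h

theorem run_of_slideIsotopic (hi : i = 0 ∨ i = 1) (hy : ∃ t, y ++ [i] = 0 :: t)
    {w w' : List Piece} (h : SlideIsotopic w w') (hw : run i p r y start w = some done) :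
    run i p r y start w' = some done := by
  induction h with
  | refl => exact hw
  | tail _ h ih => exact h.run_eq_done hi hy ih

/-- The diagram `y, α, β, ᾱ ^ p, β ^ n` is awkward, whatever list `l` of entries describes it. -/
theorem isAwkward_of_eq {x l : List ℤ} {m n : ℕ} (hx : ∀ t ∈ x, 0 < t) (hm : 0 < m) (hn : 2 ≤ n)
    (h2 : ∀ t ∈ (x ++ [(m : ℤ)]).head?, 2 ≤ t) (hi : i = x.length % 2)
    (hl : D l = cup 1 :: ((positions 0 x ++ List.replicate m i).map alt ++
      alt i :: anti (1 - i) :: (List.replicate p (anti i) ++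
        (List.replicate n (anti (1 - i)) ++ [cap i]))))
    (hc : complexity l = complexity x + m + n + if p = 0 then 4 else p + 6) :
    IsAwkward l := by
  have hi' : i = 0 ∨ i = 1 := by omega
  refine ⟨fun c l' hc' h => ?_, ?_⟩
  · obtain ⟨y, hy₁, hy₂⟩ := exists_positions_eq hx hm h2
    obtain ⟨r, rfl⟩ := Nat.exists_eq_add_of_le' hn
    rw [← hi] at hy₁ hy₂
    have h₁ := run_of_slideIsotopic (p := p) (r := r) hi' hy₂ h
      (by rw [hl, hy₁]; exact run_start hi')
    have h₂ := complexity_of_run hi' hy₂ hc' h₁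
    have h₃ := pathCost_positions (c := 0) (e := i) (Nat.zero_le 1) hm hx (by omega)
    rw [hy₁, pathCost, cost, if_pos rfl] at h₃
    split_ifs at hc h₂ <;> omega
  · rw [hl, ← List.cons_append]
    exact not_isAlternating hi' _ _

/-! ### Isotopies -/

open scoped Classical in
/-- The isotopy class of the closure of a diagram; `none` if it is not a long link diagram. -/
noncomputable def closureClass (w : List Piece) : Option Link :=
  if h : IsTangle 1 w 1 then some (Quotient.mk isotopySetoid ⟨closure w, isTangle_closure h⟩)
  else none

/-- Elementary moves remain elementary moves when a strand is added above the diagram. -/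
theorem LocalMove.shift {u v : List Piece} (h : LocalMove u v) :
    LocalMove (u.map fun p => p.moveTo (p.pos + 1)) (v.map fun p => p.moveTo (p.pos + 1)) := by
  cases h with
  | exchange p q h =>
    have := LocalMove.exchange (p.moveTo (p.pos + 1)) (q.moveTo (q.pos + 1))
      (by cases p <;> cases q <;> simp only [Piece.pos, Piece.outs, Piece.moveTo] at * <;> omega)
    have e : ((q.moveTo (q.pos - p.outs + p.ins)).moveTo
        ((q.moveTo (q.pos - p.outs + p.ins)).pos + 1)) = (q.moveTo (q.pos + 1)).moveTo
          ((q.moveTo (q.pos + 1)).pos - (p.moveTo (p.pos + 1)).outs +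
            (p.moveTo (p.pos + 1)).ins) := by
      cases p <;> cases q <;> simp only [Piece.pos, Piece.ins, Piece.outs, Piece.moveTo] at * <;>
        congr 1 <;> omega
    simp only [List.map_cons, List.map_nil, e]
    exact this
  | zigzag_down c => exact .zigzag_down (c + 1)
  | zigzag_up c => exact .zigzag_up (c + 1)
  | slide_cap c s => exact .slide_cap (c + 1) s
  | slide_cup c s => exact .slide_cup (c + 1) s
  | reidemeister_one_cap c s => exact .reidemeister_one_cap (c + 1) s
  | reidemeister_one_cup c s => exact .reidemeister_one_cup (c + 1) s
  | reidemeister_two c s => exact .reidemeister_two (c + 1) s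
  | reidemeister_three c s₁ s₂ s₃ h => exact .reidemeister_three (c + 1) s₁ s₂ s₃ h

theorem Step.closure {w w' : List Piece} (h : Step 1 1 w w') :
    Step 0 0 (closure w) (closure w') := by
  obtain ⟨hw, hw', u, v, a, b, rfl, rfl, h⟩ := h
  refine ⟨isTangle_closure hw, isTangle_closure hw', cup 0 :: u.map fun p => p.moveTo (p.pos + 1),
    (v.map fun p => p.moveTo (p.pos + 1)) ++ [cap 0], _, _, ?_, ?_,
    h.imp LocalMove.shift LocalMove.shift⟩ <;> simp [TwoBridge.closure]

theorem IsTangle.unique {u : List Piece} {n k k' : ℕ} (h : IsTangle n u k)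
    (h' : IsTangle n u k') : k = k' := by
  induction u generalizing n with
  | nil => exact h.symm.trans h'
  | cons x u ih => exact ih h.2 h'.2

/-- In a long link diagram, `u` can be replaced by `v` after any part that ends with three strands,
without changing the isotopy class of the closure.  Nothing is required of what follows: if one of
the two diagrams is not a long link diagram, then neither is the other. -/
def Replaceable (u v : List Piece) : Prop :=
  ∀ w z, IsTangle 1 w 3 → closureClass (w ++ u ++ z) = closureClass (w ++ v ++ z)

theorem LocalMove.replaceable {u v : List Piece} (h : LocalMove u v) {k : ℕ}
    (hu : IsTangle 3 u k) (hv : IsTangle 3 v k) : Replaceable u v := by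
  intro w z hw
  have aux {u : List Piece} (hu : IsTangle 3 u k) :
      IsTangle 1 (w ++ u ++ z) 1 ↔ IsTangle k z 1 := by
    refine ⟨fun h => ?_, fun h => isTangle_append (isTangle_append hw hu) h⟩
    obtain ⟨l, h₁, h₂⟩ := isTangle_append_iff.1 h
    rwa [h₁.unique (isTangle_append hw hu)] at h₂
  unfold closureClass
  by_cases hz : IsTangle k z 1
  · have h₁ := (aux hu).2 hz
    have h₂ := (aux hv).2 hz
    rw [dif_pos h₁, dif_pos h₂]
    exact congrArg some (Quotient.sound (.rel _ _
      (Step.closure ⟨h₁, h₂, w, z, u, v, rfl, rfl, .inl h⟩)))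
  · rw [dif_neg (mt (aux hu).1 hz), dif_neg (mt (aux hv).1 hz)]

theorem Replaceable.refl (u : List Piece) : Replaceable u u := fun _ _ _ => rfl

theorem Replaceable.symm {u v : List Piece} (h : Replaceable u v) : Replaceable v u :=
  fun w z hw => (h w z hw).symm

theorem Replaceable.trans {u v w : List Piece} (h : Replaceable u v) (h' : Replaceable v w) :
    Replaceable u w := fun x z hx => (h x z hx).trans (h' x z hx)

theorem Replaceable.append_right {u v : List Piece} (h : Replaceable u v) (w : List Piece) :
    Replaceable (u ++ w) (v ++ w) := fun x z hx => by
  simpa using h x (w ++ z) hx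

theorem Replaceable.append_left {u v w : List Piece} (hw : IsTangle 3 w 3) (h : Replaceable u v) :
    Replaceable (w ++ u) (w ++ v) := fun x z hx => by
  simpa using h (x ++ w) z (isTangle_append hx hw)

theorem Replaceable.cons {u v : List Piece} {c : ℕ} (hc : c ≤ 1) (s : Bool)
    (h : Replaceable u v) : Replaceable (cross c s :: u) (cross c s :: v) :=
  Replaceable.append_left (w := [cross c s]) ⟨by simpa [Piece.pos, Piece.ins] using hc, rfl⟩ h

theorem isTangle_cross_cons {c k : ℕ} (hc : c ≤ 1) (s : Bool) {w : List Piece}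
    (hw : IsTangle 3 w k) : IsTangle 3 (cross c s :: w) k :=
  ⟨by simpa [Piece.pos, Piece.ins] using hc, hw⟩

theorem isTangle_cap {c : ℕ} (hc : c ≤ 1) : IsTangle 3 [cap c] 1 :=
  ⟨by simpa [Piece.pos, Piece.ins] using hc, rfl⟩

theorem replaceable_reidemeister_two {c : ℕ} (hc : c ≤ 1) (s : Bool) :
    Replaceable [cross c s, cross c (!s)] [] :=
  (LocalMove.reidemeister_two c s).replaceable
    (isTangle_cross_cons hc _ (isTangle_cross_cons hc _ rfl)) rfl

theorem replaceable_reidemeister_one_cap {c : ℕ} (hc : c ≤ 1) (s : Bool) :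
    Replaceable [cross c s, cap c] [cap c] :=
  (LocalMove.reidemeister_one_cap c s).replaceable
    (isTangle_cross_cons hc _ (isTangle_cap hc)) (isTangle_cap hc)

/-- A form of the slide that treats both places alike; for `c = 1` it is the move read backwards. -/
theorem replaceable_slide_cap {c : ℕ} (hc : c ≤ 1) (s : Bool) :
    Replaceable [cross c s, cap (1 - c)] [cross (1 - c) (!s), cap c] := by
  have h (s : Bool) : Replaceable [cross 0 s, cap 1] [cross 1 (!s), cap 0] :=
    (LocalMove.slide_cap 0 s).replaceable
      (isTangle_cross_cons zero_le_one _ (isTangle_cap le_rfl))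
      (isTangle_cross_cons le_rfl _ (isTangle_cap zero_le_one))
  obtain rfl | rfl : c = 0 ∨ c = 1 := by omega
  · exact h s
  · simpa using (h !s).symm

theorem replaceable_reidemeister_three {c : ℕ} (hc : c ≤ 1) {s₁ s₂ s₃ : Bool}
    (h : s₁ = s₂ ∨ s₂ = s₃) :
    Replaceable [cross c s₁, cross (1 - c) s₂, cross c s₃]
      [cross (1 - c) s₃, cross c s₂, cross (1 - c) s₁] := by
  have aux {s₁ s₂ s₃ : Bool} (h : s₁ = s₂ ∨ s₂ = s₃) :
      Replaceable [cross 0 s₁, cross 1 s₂, cross 0 s₃] [cross 1 s₃, cross 0 s₂, cross 1 s₁] :=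
    (LocalMove.reidemeister_three 0 s₁ s₂ s₃ h).replaceable
      (isTangle_cross_cons zero_le_one _ (isTangle_cross_cons le_rfl _
        (isTangle_cross_cons zero_le_one _ rfl)))
      (isTangle_cross_cons le_rfl _ (isTangle_cross_cons zero_le_one _
        (isTangle_cross_cons le_rfl _ rfl)))
  obtain rfl | rfl : c = 0 ∨ c = 1 := by omega
  · exact aux h
  · exact (aux (h.symm.imp Eq.symm Eq.symm)).symm

theorem isTangle_replicate {c : ℕ} (hc : c ≤ 1) (s : Bool) (n : ℕ) :
    IsTangle 3 (List.replicate n (cross c s)) 3 :=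
  isTangle_crossings fun _ h => ⟨c, s, List.eq_of_mem_replicate h, by omega⟩

/-- `α ^ n β α = β α β ^ n`. -/
theorem replaceable_replicate_cross {c : ℕ} (hc : c ≤ 1) (s : Bool) (n : ℕ) :
    Replaceable (List.replicate n (cross c s) ++ [cross (1 - c) s, cross c s])
      ([cross (1 - c) s, cross c s] ++ List.replicate n (cross (1 - c) s)) := by
  induction n with
  | zero => exact .refl _
  | succ n ih =>
    refine (ih.cons hc s).trans ?_
    simpa [List.replicate_succ] using (replaceable_reidemeister_three hc (.inl rfl)).append_right
      (List.replicate n (cross (1 - c) s))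

/-- The chain of diagrams is
`β̄ α ^ n cap' = β̄ α ^ n β cap' = β̄ α ^ n β α ᾱ cap' = β̄ β α β ^ n ᾱ cap' = α β ^ n β cap`,
where `cap' = cap (1 - c)` and `cap = cap c`. -/
theorem replaceable_twist_cap {c : ℕ} (hc : c ≤ 1) (s : Bool) (n : ℕ) :
    Replaceable (cross (1 - c) (!s) :: (List.replicate n (cross c s) ++ [cap (1 - c)]))
      (cross c s :: (List.replicate (n + 1) (cross (1 - c) s) ++ [cap c])) := by
  have hc' : 1 - c ≤ 1 := by omega
  have hn := isTangle_replicate hc s n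
  have hn' := isTangle_replicate hc' s n
  have h₁ : Replaceable (List.replicate n (cross c s) ++ [cap (1 - c)])
      (List.replicate n (cross c s) ++ [cross (1 - c) s, cap (1 - c)]) :=
    .append_left hn (replaceable_reidemeister_one_cap hc' s).symm
  have h₂ : Replaceable (List.replicate n (cross c s) ++ [cross (1 - c) s, cap (1 - c)])
      (List.replicate n (cross c s) ++
        [cross (1 - c) s, cross c s, cross c (!s), cap (1 - c)]) :=
    .append_left hn (.cons hc' s
      ((replaceable_reidemeister_two hc s).symm.append_right [cap (1 - c)]))
  have h₃ := (replaceable_replicate_cross hc s n).append_right [cross c (!s), cap (1 - c)]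
  have h₄ : Replaceable ([cross (1 - c) s, cross c s] ++ List.replicate n (cross (1 - c) s) ++
        [cross c (!s), cap (1 - c)])
      ([cross (1 - c) s, cross c s] ++ List.replicate n (cross (1 - c) s) ++
        [cross (1 - c) s, cap c]) :=
    .append_left (isTangle_cross_cons hc' _ (isTangle_cross_cons hc _ hn'))
      (by simpa using replaceable_slide_cap hc (!s))
  have h₅ := (replaceable_reidemeister_two hc' (!s)).append_right
    (cross c s :: (List.replicate (n + 1) (cross (1 - c) s) ++ [cap c]))
  simp only [List.append_assoc, List.cons_append, List.nil_append] at h₁ h₂ h₃ h₄ h₅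
  refine (Replaceable.cons hc' (!s) (h₁.trans (h₂.trans (h₃.trans h₄)))).trans ?_
  simpa [List.replicate_succ'] using h₅

/-- `β̄ ^ p α β = α β ᾱ ^ p`. -/
theorem replaceable_replicate_fold {c : ℕ} (hc : c ≤ 1) (s : Bool) (p : ℕ) :
    Replaceable (List.replicate p (cross (1 - c) (!s)) ++ [cross c s, cross (1 - c) s])
      ([cross c s, cross (1 - c) s] ++ List.replicate p (cross c (!s))) := by
  have hc' : 1 - c ≤ 1 := by omega
  induction p with
  | zero => exact .refl _
  | succ p ih =>
    refine (ih.cons hc' (!s)).trans ?_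
    have h := replaceable_reidemeister_three hc' (s₁ := !s) (s₂ := s) (.inr rfl)
    rw [show 1 - (1 - c) = c by omega] at h
    simpa [List.replicate_succ] using h.append_right (List.replicate p (cross c (!s)))

/-- The part after `y` of the alternating diagram can be replaced by that of the awkward one. -/
theorem replaceable_fold {i : ℕ} (hi : i = 0 ∨ i = 1) (p n : ℕ) :
    Replaceable
      (List.replicate (p + 1) (alt (1 - i)) ++ (List.replicate n (alt i) ++ [cap (1 - i)]))
      (alt i :: anti (1 - i) :: (List.replicate p (anti i) ++
        (List.replicate n (anti (1 - i)) ++ [cap i]))) := by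
  have hi' : i ≤ 1 := by omega
  obtain ⟨s, h₁, h₂, h₃, h₄⟩ : ∃ s, alt i = cross i s ∧ alt (1 - i) = cross (1 - i) (!s) ∧
      anti i = cross i (!s) ∧ anti (1 - i) = cross (1 - i) s := by
    rcases hi with rfl | rfl
    · exact ⟨true, rfl, rfl, rfl, rfl⟩
    · exact ⟨false, rfl, rfl, rfl, rfl⟩
  rw [h₁, h₂, h₃, h₄]
  have h₅ := (replaceable_twist_cap hi' s n).append_left
    (isTangle_replicate (by omega : 1 - i ≤ 1) (!s) p)
  have h₆ := (replaceable_replicate_fold hi' s p).append_right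
    (List.replicate n (cross (1 - i) s) ++ [cap i])
  rw [List.replicate_succ', List.append_assoc]
  refine h₅.trans ?_
  simpa [List.replicate_succ] using h₆

theorem conwayLink_eq_of_replaceable {l l' : List ℤ} {w u v : List Piece} (hw : IsTangle 1 w 3)
    (h : Replaceable u v) (hl : D l = w ++ u) (hl' : D l' = w ++ v) :
    conwayLink l = conwayLink l' := by
  have h := h w [] hw
  rw [List.append_nil, List.append_nil, ← hl, ← hl'] at h
  unfold closureClass at h
  rw [dif_pos (isTrigonal_conwayDiagram (Nat.zero_le 1) l).1,
    dif_pos (isTrigonal_conwayDiagram (Nat.zero_le 1) l').1] at h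
  exact Option.some.inj h

theorem le_one_of_mem_positions {c : ℕ} (hc : c ≤ 1) (x : List ℤ) :
    ∀ d ∈ positions c x, d ≤ 1 := by
  induction x generalizing c with
  | nil => simp [positions]
  | cons m x ih =>
    intro d hd
    rcases List.mem_append.1 hd with hd | hd
    · rw [List.eq_of_mem_replicate hd]; exact hc
    · exact ih (by omega) d hd

theorem conwayLink_eq_and_isAwkward_of_eq {x l l' : List ℤ} {m n p i : ℕ}
    (hx : ∀ t ∈ x, 0 < t) (hm : 0 < m) (hn : 2 ≤ n) (h2 : ∀ t ∈ (x ++ [(m : ℤ)]).head?, 2 ≤ t) (hi : i = x.length % 2)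
    (hl : D l = cup 1 :: ((positions 0 x ++ List.replicate m i).map alt ++
      (List.replicate (p + 1) (alt (1 - i)) ++ (List.replicate n (alt i) ++ [cap (1 - i)]))))
    (hl' : D l' = cup 1 :: ((positions 0 x ++ List.replicate m i).map alt ++
      alt i :: anti (1 - i) :: (List.replicate p (anti i) ++
        (List.replicate n (anti (1 - i)) ++ [cap i]))))
    (hc : complexity l' = complexity x + m + n + if p = 0 then 4 else p + 6) :
    conwayLink l' = conwayLink l ∧ IsAwkward l' := by
  have hi' : i = 0 ∨ i = 1 := by omega
  refine ⟨(conwayLink_eq_of_replaceable (w := cup 1 ::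
    (positions 0 x ++ List.replicate m i).map alt) ?_ (replaceable_fold hi' p n) hl hl').symm,
    isAwkward_of_eq hx hm hn h2 hi hl' hc⟩
  refine ⟨le_rfl, isTangle_crossings fun q hq => ?_⟩
  obtain ⟨c, hc, rfl⟩ := List.mem_map.1 hq
  refine ⟨c, _, rfl, ?_⟩
  rcases List.mem_append.1 hc with hc | hc
  · have := le_one_of_mem_positions (Nat.zero_le 1) x c hc
    simp only [Piece.ins, Piece.outs]; omega
  · have := List.eq_of_mem_replicate hc
    simp only [Piece.ins, Piece.outs]; omega

/-! ### The two families of diagrams -/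

theorem twists_cons_of_pos {c : ℕ} (hc : c ≤ 1) {m : ℤ} (hm : 0 < m) (l : List ℤ) :
    twists c (altSign c) (m :: l) =
      List.replicate m.natAbs (alt c) ++ twists (1 - c) (altSign (1 - c)) l := by
  rw [twists, twist_of_pos hm, altSign_flip hc]

theorem twists_cons_of_nonpos {c : ℕ} (hc : c ≤ 1) {m : ℤ} (hm : m ≤ 0) (l : List ℤ) :
    twists c (altSign c) (m :: l) =
      List.replicate m.natAbs (anti c) ++ twists (1 - c) (altSign (1 - c)) l := by
  rw [twists, twist_of_nonpos hm, altSign_flip hc]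

/-- In both cases the diagram consists of the same pieces, but for `a = 1` the twists `-1` and `-n`
are adjacent and form a single group. -/
theorem conwayLink_eq_and_isAwkward {x : List ℤ} {m a n : ℤ} (hpos : ∀ t ∈ x ++ [m, a, n], 0 < t)
    (h2 : ∀ t ∈ (x ++ [m]).head?, 2 ≤ t) (hn : 2 ≤ n) :
      (1 < a → conwayLink (x ++ [m + 1, -1, 1 - a, -n]) =
          conwayLink (x ++ [m, a, n]) ∧
        IsAwkward (x ++ [m + 1, -1, 1 - a, -n])) ∧
      (a = 1 → conwayLink (x ++ [m + 1, -n - 1]) =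
          conwayLink (x ++ [m, a, n]) ∧
        IsAwkward (x ++ [m + 1, -n - 1])) := by
  have hx : ∀ t ∈ x, 0 < t := fun t ht => hpos t (by simp [ht])
  have hm : 0 < m := hpos m (by simp)
  have ha : 0 < a := hpos a (by simp)
  lift m to ℕ using hm.le
  lift n to ℕ using by omega
  obtain ⟨p, rfl⟩ : ∃ p : ℕ, a = p + 1 := ⟨(a - 1).toNat, by omega⟩
  obtain ⟨i, hi⟩ : ∃ i, i = x.length % 2 := ⟨_, rfl⟩
  have hi' : i ≤ 1 := by omega
  have hi'' : 1 - (1 - i) = i := by omega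
  have h0 : D (x ++ [(m : ℤ), p + 1, n]) = Piece.cup 1 :: ((positions 0 x ++ List.replicate m i).map
      alt ++ (List.replicate (p + 1) (alt (1 - i)) ++ (List.replicate n (alt i) ++
        [Piece.cap (1 - i)]))) := by
    rw [conwayDiagram_append hx, ← hi, twists_cons_of_pos hi' hm,
      twists_cons_of_pos (by omega) ha, hi'', twists_cons_of_pos hi' (by omega), twists,
      if_neg (by simp [Nat.even_iff])]
    simp [Int.natAbs_natCast, show ((p : ℤ) + 1).natAbs = p + 1 by omega]
  refine ⟨fun h => conwayLink_eq_and_isAwkward_of_eq (p := p) (n := n) hx (by omega) (by omega) h2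
      hi h0 ?_ ?_,
    fun h => conwayLink_eq_and_isAwkward_of_eq (p := p) (n := n) hx (by omega) (by omega) h2
      hi h0 ?_ ?_⟩
  · rw [conwayDiagram_append hx, ← hi, twists_cons_of_pos hi' (by omega),
      twists_cons_of_nonpos (by omega) (by omega), hi'', twists_cons_of_nonpos hi' (by omega),
      twists_cons_of_nonpos (by omega) (by omega), twists, if_pos (by simp [Nat.even_iff]),
      show ((m : ℤ) + 1).natAbs = m + 1 by omega, show (1 - ((p : ℤ) + 1)).natAbs = p by omega]
    simp [List.replicate_succ']
  · rw [complexity_append, if_neg (by omega)]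
    simp only [complexity, List.length_cons, List.length_nil, List.map_cons, List.map_nil,
      List.sum_cons, List.sum_nil]
    omega
  · obtain rfl : p = 0 := by omega
    rw [conwayDiagram_append hx, ← hi, twists_cons_of_pos hi' (by omega),
      twists_cons_of_nonpos (by omega) (by omega), twists, if_pos (by simp),
      show ((m : ℤ) + 1).natAbs = m + 1 by omega, show (-(n : ℤ) - 1).natAbs = n + 1 by omega]
    rw [List.replicate_succ', List.replicate_succ]
    simp
  · rw [complexity_append, if_pos (by omega)]
    simp only [complexity, List.length_cons, List.length_nil, List.map_cons, List.map_nil,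
      List.sum_cons, List.sum_nil]
    omega

end TwoBridge

theorem mainTheorem3 (l : List ℤ) (hk : 3 ≤ l.length) (hpos : ∀ t ∈ l, 0 < t)
    (hfirst : (2 : ℤ) ≤ l[0]) (hlast : (2 : ℤ) ≤ l[l.length - 1])
    (K : TwoBridge.Link) (hK : K = TwoBridge.conwayLink l) :
    (∃ l' : List ℤ, (∀ t ∈ l', t ≠ 0) ∧ TwoBridge.conwayLink l' = K ∧ TwoBridge.IsAwkward l') ∧
    ∀ (x : List ℤ) (m a n : ℤ), l = x ++ [m, a, n] →
      (1 < a → TwoBridge.conwayLink (x ++ [m + 1, -1, 1 - a, -n]) = K ∧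
        TwoBridge.IsAwkward (x ++ [m + 1, -1, 1 - a, -n])) ∧
      (a = 1 → TwoBridge.conwayLink (x ++ [m + 1, -n - 1]) = K ∧
        TwoBridge.IsAwkward (x ++ [m + 1, -n - 1])) := by
  subst hK
  have key : ∀ (x : List ℤ) (m a n : ℤ), l = x ++ [m, a, n] →
      (1 < a → TwoBridge.conwayLink (x ++ [m + 1, -1, 1 - a, -n]) = TwoBridge.conwayLink l ∧
        TwoBridge.IsAwkward (x ++ [m + 1, -1, 1 - a, -n])) ∧
      (a = 1 → TwoBridge.conwayLink (x ++ [m + 1, -n - 1]) = TwoBridge.conwayLink l ∧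
        TwoBridge.IsAwkward (x ++ [m + 1, -n - 1])) := by
    rintro x m a n rfl
    refine TwoBridge.conwayLink_eq_and_isAwkward hpos ?_ (by simpa using hlast)
    rcases x with _ | ⟨k, x⟩ <;> simpa using hfirst
  refine ⟨?_, key⟩
  obtain ⟨x, m, a, n, rfl⟩ : ∃ x m a n, l = x ++ [m, a, n] := by
    have hlen : (l.drop (l.length - 3)).length = 3 := by rw [List.length_drop]; omega
    obtain ⟨m, a, n, h⟩ := List.length_eq_three.1 hlen
    exact ⟨l.take (l.length - 3), m, a, n, by rw [← h, List.take_append_drop]⟩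
  have ha : 0 < a := hpos a (by simp)
  have hm : 0 < m := hpos m (by simp)
  have hn : 0 < n := hpos n (by simp)
  have hx : ∀ t ∈ x, t ≠ 0 := fun t ht => (hpos t (by simp [ht])).ne'
  obtain ⟨h₁, h₂⟩ := key x m a n rfl
  rcases eq_or_lt_of_le (Int.add_one_le_of_lt ha : 1 ≤ a) with h | h
  · refine ⟨_, fun t ht => ?_, h₂ h.symm⟩
    simp only [List.mem_append, List.mem_cons, List.not_mem_nil, or_false] at ht
    rcases ht with ht | rfl | rfl
    · exact hx t ht
    all_goals omega
  · refine ⟨_, fun t ht => ?_, h₁ h⟩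
    simp only [List.mem_append, List.mem_cons, List.not_mem_nil, or_false] at ht
    rcases ht with ht | rfl | rfl | rfl | rfl
    · exact hx t ht
    all_goals omega
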